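/- Let $G=F_2*S_{18}$ be the free product of the free group of rank $2$ and the symmetric group on $18$ letters, and let $X$ be the boundary of the Cayley tree of the free group $F_3$ on three free generators, i.e. the space of infinite reduced words in the generators and their inverses, where two words are close if they share a long common prefix. Then $X$ is a compact Polish space, homeomorphic to the Cantor space $\{0,1\}^{\mathbb N}$, and there exist a finite symmetric set $A=A^{-1}\subseteq G$ generating $G$ and an action of $G$ on $X$ by homeomorphisms such that: (1) the action is highly topologically transitive, i.e. for every $k\in\mathbb N$ the diagonal action of $G$ on $X^k$ is topologically transitive (for all non-empty open $U,V\subseteq X^k$ there is $g\in G$ with $g(U)\cap V\neq\emptyset$); (2) for the uniform probability measure $\mu$ on $A$, the action is not topologically $\mu$-mixing, i.e. it is not the case that $\lim_{n\to\infty}\mu^{*n}(\{g\in G : g(U)\cap V\neq\emptyset\})=1$ for all non-empty open $U,V\subseteq X$, where $\mu^{*n}$ denotes the $n$-fold convolution power of $\mu$. -/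

import Mathlib

open MeasureTheory

/-- The set `N(U, V) = {g ∈ G | g(U) ∩ V ≠ ∅}`. -/
def hittingSet (G : Type*) {X : Type*} [Group G] [MulAction G X] (U V : Set X) : Set G :=
  {g | (((fun x => g • x) '' U) ∩ V).Nonempty}

/-- An action is highly topologically transitive if for every `k` the diagonal action on
`X ^ k` (with the product topology) is topologically transitive. -/
def IsHighlyTopologicallyTransitive (G X : Type*) [Group G] [TopologicalSpace X]
    [MulAction G X] : Prop :=
  ∀ k : ℕ, MulAction.IsTopologicallyTransitive G (Fin k → X)

/-- The `n`-fold convolution power of a measure on a group; the `0`-th power is the Dirac mass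
at the identity. -/
noncomputable def convPow {G : Type*} [Group G] [MeasurableSpace G] (μ : Measure G) :
    ℕ → Measure G
  | 0 => Measure.dirac 1
  | n + 1 => (convPow μ n).mconv μ

/-- The action is topologically `μ`-mixing if the `μ`-random walk hits `N(U, V)` with
probability tending to `1`, for all non-empty open `U` and `V`. It is meant for countable groups
in which every subset is measurable. -/
def IsTopologicallyMuMixing (G X : Type*) [Group G] [MeasurableSpace G] [TopologicalSpace X]
    [MulAction G X] (μ : Measure G) : Prop :=
  ∀ U V : Set X, IsOpen U → U.Nonempty → IsOpen V → V.Nonempty →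
    Filter.Tendsto (fun n : ℕ => convPow μ n (hittingSet G U V)) Filter.atTop (nhds 1)

/-- The free product of the free group of rank two and the symmetric group on `18` letters. -/
abbrev FreeProdF2S18 : Type :=
  Monoid.Coprod (FreeGroup (Fin 2)) (Equiv.Perm (Fin 18))

/-- The group is discrete: every subset is measurable. -/
instance instMeasurableSpaceFreeProdF2S18 : MeasurableSpace FreeProdF2S18 := ⊤

instance instDiscreteMeasurableSpaceFreeProdF2S18 : DiscreteMeasurableSpace FreeProdF2S18 :=
  ⟨fun _ => trivial⟩

/-- The boundary of the Cayley tree of the free group of rank `3`: infinite reduced words in the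
letters and their inverses. The letter `(a, true)` stands for the generator `a` and `(a, false)`
for its inverse, so a word is reduced when adjacent letters with the same generator have the same
sign. -/
def F3Boundary : Type :=
  {w : ℕ → Fin 3 × Bool // ∀ n, (w n).1 = (w (n + 1)).1 → (w n).2 = (w (n + 1)).2}

/-- The topology of long common prefixes, i.e. the one induced by the product topology. -/
instance instTopologicalSpaceF3Boundary : TopologicalSpace F3Boundary :=
  inferInstanceAs (TopologicalSpace
    {w : ℕ → Fin 3 × Bool // ∀ n, (w n).1 = (w (n + 1)).1 → (w n).2 = (w (n + 1)).2})

/-! The boundary of the tree is a Cantor set, hence homeomorphic to the full shift on 18 letters,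
and it suffices to let the group act there. The symmetric group permutes the first letter; the free
generators act by `shift 0 1` and `shift 2 3`, which delete or insert a first letter, except for an
exchange `p q ↔ q p`. The set `A` consists of the symmetric group, the free generators and their
inverses.

Failure of mixing: `shift p q` lengthens every cylinder whose first letter is not `p`, so at most
one of the four shifts shortens a given cylinder and the others lengthen it, while permutations keep
the length (`exists_lengthening`). Hence `2 ^ (-length)` does not increase on average
(`sum_le_card_mul`), and at each time the image of a cylinder of length two lies in a cylinder of
length one with probability at least `1 / 2` (`convPow_not_sharesPrefix_le`). The image thus meets
two disjoint cylinders of length one with probability at most `1 / 2`, so the two hitting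
probabilities cannot both tend to `1`.

High transitivity: the group contains the exchange of any two distinct cylinders of equal length
(`swappable_of_length_eq`). Exchanges of small cylinders move finitely many distinct points one at a
time into prescribed open sets while the other points stay fixed (`exists_forall_mem_of_swappable`).
-/

namespace Word

/-! ### Infinite words and their prefixes -/

variable {α : Type*}

/-- The infinite word `i x`. -/
def cons (i : α) (x : ℕ → α) : ℕ → α
  | 0 => i
  | n + 1 => x n

/-- The infinite word `x` without its first letter. -/
def tail (x : ℕ → α) : ℕ → α := fun n => x (n + 1)

@[simp] theorem cons_zero (i : α) (x : ℕ → α) : cons i x 0 = i := rfl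

@[simp] theorem cons_succ (i : α) (x : ℕ → α) (n : ℕ) : cons i x (n + 1) = x n := rfl

@[simp] theorem cons_one (i : α) (x : ℕ → α) : cons i x 1 = x 0 := rfl

@[simp] theorem tail_apply (x : ℕ → α) (n : ℕ) : tail x n = x (n + 1) := rfl

@[simp] theorem tail_cons (i : α) (x : ℕ → α) : tail (cons i x) = x := rfl

theorem eq_cons_tail (x : ℕ → α) : x = cons (x 0) (tail x) := by
  funext n; cases n <;> rfl

theorem continuous_cons [TopologicalSpace α] (i : α) : Continuous (cons i : (ℕ → α) → ℕ → α) := by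
  refine continuous_pi fun n => ?_
  cases n with
  | zero => exact continuous_const
  | succ n => exact continuous_apply n

theorem continuous_tail [TopologicalSpace α] : Continuous (tail : (ℕ → α) → ℕ → α) :=
  continuous_pi fun n => continuous_apply (n + 1)

/-- The infinite word `u x` for a finite word `u`. -/
def prepend (u : List α) (x : ℕ → α) : ℕ → α := u.foldr cons x

@[simp] theorem prepend_nil (x : ℕ → α) : prepend [] x = x := rfl

@[simp] theorem prepend_cons (i : α) (u : List α) (x : ℕ → α) :
    prepend (i :: u) x = cons i (prepend u x) := rfl

theorem cons_injective {i j : α} {x y : ℕ → α} (h : cons i x = cons j y) : i = j ∧ x = y :=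
  ⟨congrFun h 0, congrArg tail h⟩

theorem eq_of_prepend_eq {u v : List α} {x y : ℕ → α} (hl : u.length = v.length)
    (h : prepend u x = prepend v y) : u = v := by
  induction u generalizing v with
  | nil => simpa [eq_comm] using hl
  | cons i u ih =>
    cases v with
    | nil => simp at hl
    | cons j v =>
      obtain ⟨h1, h2⟩ := cons_injective h
      rw [h1, ih (by simpa using hl) h2]

/-- The first `n` letters of an infinite word. -/
def pref (n : ℕ) (x : ℕ → α) : List α := List.ofFn fun i : Fin n => x i

@[simp] theorem length_pref (n : ℕ) (x : ℕ → α) : (pref n x).length = n := by simp [pref]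

theorem prepend_pref (n : ℕ) (x : ℕ → α) : prepend (pref n x) (fun k => x (n + k)) = x := by
  induction n generalizing x with
  | zero => simp [pref]
  | succ n ih =>
    have h := ih (tail x)
    have : pref (n + 1) x = x 0 :: pref n (tail x) := by simp [pref, List.ofFn_succ]
    rw [this, prepend_cons]
    conv_rhs => rw [eq_cons_tail x, ← h]
    congr 2
    funext k
    simp only [tail_apply]
    congr 1
    omega

theorem pref_prepend (u : List α) (x : ℕ → α) : pref u.length (prepend u x) = u :=
  eq_of_prepend_eq (by simp) (prepend_pref _ _)

theorem pref_eq_iff {n : ℕ} {x y : ℕ → α} : pref n x = pref n y ↔ ∀ i < n, x i = y i := by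
  simp only [pref, List.ofFn_inj]
  exact ⟨fun h i hi => congrFun h ⟨i, hi⟩, fun h => funext fun i => h i i.2⟩

/-! ### The prefix replacements that generate the action -/

section Flip

variable [DecidableEq α]

/-- The prefix replacement which removes a first letter `p` where the next letter is not `q`,
exchanges the initial letters `p q` by `q p`, and adds the letter `q` in front of all other words. -/
def shiftFun (p q : α) (x : ℕ → α) : ℕ → α :=
  if x 0 = p then if x 1 = q then cons q (cons p (tail (tail x))) else tail x else cons q x

theorem shiftFun_shiftFun (p q : α) (x : ℕ → α) :
    shiftFun q p (shiftFun p q x) = x := by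
  rw [eq_cons_tail x, eq_cons_tail (tail x)]
  simp only [shiftFun]
  by_cases h0 : x 0 = p
  · by_cases h1 : x 1 = q <;> simp [h0, h1]
  · simp [h0]

/-- `shiftFun p q` as a permutation, with inverse `shiftFun q p`. -/
def shift (p q : α) : Equiv.Perm (ℕ → α) where
  toFun := shiftFun p q
  invFun := shiftFun q p
  left_inv := shiftFun_shiftFun p q
  right_inv := shiftFun_shiftFun q p

theorem shift_apply (p q : α) (x : ℕ → α) : shift p q x = shiftFun p q x := rfl

theorem shift_inv (p q : α) : (shift p q)⁻¹ = shift q p := rfl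

theorem shift_cons_of_ne {p q i : α} (hi : i ≠ p) (x : ℕ → α) :
    shift p q (cons i x) = cons q (cons i x) := by
  simp [shift_apply, shiftFun, hi]

theorem shift_cons_cons {p q i : α} (hi : i ≠ q) (x : ℕ → α) :
    shift p q (cons p (cons i x)) = cons i x := by
  simp [shift_apply, shiftFun, hi]

theorem shift_exchange (p q : α) (x : ℕ → α) :
    shift p q (cons p (cons q x)) = cons q (cons p x) := by
  simp [shift_apply, shiftFun]

theorem continuous_shiftFun [TopologicalSpace α] [DiscreteTopology α] (p q : α) :
    Continuous (shiftFun p q) := by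
  have hcl (n : ℕ) (i : α) : IsClopen {x : ℕ → α | x n = i} :=
    (isClopen_discrete {i}).preimage (continuous_apply n)
  unfold shiftFun
  refine Continuous.if (fun x hx => ?_) (Continuous.if (fun x hx => ?_) ?_ ?_) ?_
  · simp [(hcl 0 p).frontier_eq] at hx
  · simp [(hcl 1 q).frontier_eq] at hx
  · exact (continuous_cons q).comp ((continuous_cons p).comp (continuous_tail.comp continuous_tail))
  · exact continuous_tail
  · exact continuous_cons q

end Flip

/-- The action of permutations of the alphabet on the first letter. -/
def firstLetter : Equiv.Perm α →* Equiv.Perm (ℕ → α) where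
  toFun σ :=
    { toFun := fun x => cons (σ (x 0)) (tail x)
      invFun := fun x => cons (σ⁻¹ (x 0)) (tail x)
      left_inv := fun x => by simp [← eq_cons_tail]
      right_inv := fun x => by simp [← eq_cons_tail] }
  map_one' := Equiv.ext fun x => (eq_cons_tail x).symm
  map_mul' _ _ := rfl

theorem firstLetter_apply (σ : Equiv.Perm α) (x : ℕ → α) :
    firstLetter σ x = cons (σ (x 0)) (tail x) := rfl

@[simp] theorem firstLetter_cons (σ : Equiv.Perm α) (i : α) (x : ℕ → α) :
    firstLetter σ (cons i x) = cons (σ i) x := rfl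

theorem continuous_firstLetter [TopologicalSpace α] [DiscreteTopology α] (σ : Equiv.Perm α) :
    Continuous (firstLetter σ) := by
  refine continuous_pi fun n => ?_
  cases n with
  | zero => exact continuous_of_discreteTopology.comp (continuous_apply 0)
  | succ n => exact continuous_apply (n + 1)

/-! ### Exchanging cylinders -/

/-- The group `H` contains the exchange of the cylinders of `u` and `v`. -/
def Swappable (H : Subgroup (Equiv.Perm (ℕ → α))) (u v : List α) : Prop :=
  ∃ g ∈ H, (∀ x, g (prepend u x) = prepend v x) ∧ (∀ x, g (prepend v x) = prepend u x) ∧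
    ∀ z, (∀ x, z ≠ prepend u x) → (∀ x, z ≠ prepend v x) → g z = z

section Swappable

variable {H : Subgroup (Equiv.Perm (ℕ → α))}

theorem Swappable.symm {u v : List α} (h : Swappable H u v) : Swappable H v u := by
  obtain ⟨g, hg, h1, h2, h3⟩ := h
  exact ⟨g, hg, h2, h1, fun z a b => h3 z b a⟩

theorem Swappable.conj {u v u' v' : List α} (hs : Swappable H u v) {h : Equiv.Perm (ℕ → α)}
    (hh : h ∈ H) (hu : ∀ x, h (prepend u x) = prepend u' x)
    (hv : ∀ x, h (prepend v x) = prepend v' x) : Swappable H u' v' := by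
  obtain ⟨g, hg, h1, h2, h3⟩ := hs
  refine ⟨h * g * h⁻¹, H.mul_mem (H.mul_mem hh hg) (H.inv_mem hh), fun x => ?_, fun x => ?_,
    fun z hz1 hz2 => ?_⟩
  · rw [← hu x]; simp [Equiv.Perm.mul_apply, h1, hv]
  · rw [← hv x]; simp [h2, hu]
  · have : g (h⁻¹ z) = h⁻¹ z := by
      refine h3 _ (fun x hx => hz1 x ?_) (fun x hx => hz2 x ?_)
      · rw [← hu x, ← hx]; simp
      · rw [← hv x, ← hx]; simp
    rw [Equiv.Perm.mul_apply, Equiv.Perm.mul_apply, this]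
    exact h.apply_symm_apply z

/-- The exchange of `u` and `v` fixes the cylinder of `w`, so it conjugates the exchange of `v` and
`w` into that of `u` and `w`. -/
theorem Swappable.trans {u v w : List α} (huv : Swappable H u v) (hvw : Swappable H v w)
    (hwu : ∀ x y, prepend w x ≠ prepend u y) (hwv : ∀ x y, prepend w x ≠ prepend v y) :
    Swappable H u w := by
  obtain ⟨g, hg, h1, h2, h3⟩ := huv
  exact hvw.conj hg h2 fun x => h3 _ (hwu x) (hwv x)

theorem Swappable.cons_of_ne [DecidableEq α] {p q i j : α} {c d : List α}
    (hT : shift p q ∈ H) (hs : Swappable H (i :: c) (j :: d)) (hi : i ≠ p) (hj : j ≠ p) :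
    Swappable H (q :: i :: c) (q :: j :: d) :=
  hs.conj hT (fun _ => shift_cons_of_ne hi _) (fun _ => shift_cons_of_ne hj _)

theorem swappable_permute (hσ : ∀ σ, firstLetter σ ∈ H) (σ : Equiv.Perm α) {i j : α}
    {c d : List α} (hs : Swappable H (i :: c) (j :: d)) : Swappable H (σ i :: c) (σ j :: d) :=
  hs.conj (hσ σ) (fun _ => rfl) (fun _ => rfl)

theorem swappable_singleton [DecidableEq α] (hσ : ∀ σ, firstLetter σ ∈ H) (i j : α) :
    Swappable H [i] [j] := by
  refine ⟨firstLetter (Equiv.swap i j), hσ _, fun x => by simp, fun x => by simp,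
    fun z h1 h2 => ?_⟩
  have hi : z 0 ≠ i := fun h => h1 (tail z) (by simp [← h, ← eq_cons_tail])
  have hj : z 0 ≠ j := fun h => h2 (tail z) (by simp [← h, ← eq_cons_tail])
  rw [firstLetter_apply, Equiv.swap_apply_of_ne_of_ne hi hj, ← eq_cons_tail]

/-- The maps `shift p q`, its inverse and `shift r s` insert a letter unless the word starts with
`p`, `q`, `r` respectively. One of these three distinct letters differs from both `i` and `j`, and
the inserted letter can then be renamed to `k`. -/
theorem swappable_same_first [DecidableEq α] {p q r s : α}
    (hpq : p ≠ q) (hpr : p ≠ r) (hqr : q ≠ r)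
    (hσ : ∀ σ, firstLetter σ ∈ H) (h1 : shift p q ∈ H) (h2 : shift r s ∈ H) (k i j : α)
    {c d : List α} (hs : Swappable H (i :: c) (j :: d)) :
    Swappable H (k :: i :: c) (k :: j :: d) := by
  have key (l : α) (h : Swappable H (l :: i :: c) (l :: j :: d)) :
      Swappable H (k :: i :: c) (k :: j :: d) := by
    simpa using swappable_permute hσ (Equiv.swap l k) h
  by_cases hp : i ≠ p ∧ j ≠ p
  · exact key q (hs.cons_of_ne h1 hp.1 hp.2)
  by_cases hq : i ≠ q ∧ j ≠ q
  · exact key p (hs.cons_of_ne (by rw [← shift_inv p q]; exact H.inv_mem h1)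
      hq.1 hq.2)
  · refine key s (hs.cons_of_ne h2 ?_ ?_) <;> grind

/-- If one can exchange cylinders of length `n + 1`, then one can exchange a cylinder of length
`n + 2` with a cylinder of length `n + 1` elsewhere. -/
theorem swappable_of_length_ne [DecidableEq α] {p q r s : α}
    (hpq : p ≠ q) (hpr : p ≠ r) (hqr : q ≠ r)
    (hσ : ∀ σ, firstLetter σ ∈ H) (h1 : shift p q ∈ H) (h2 : shift r s ∈ H) {n : ℕ}
    (ih : ∀ u v : List α, u.length = n + 1 → v.length = n + 1 → u ≠ v → Swappable H u v)
    {k i : α} (hki : k ≠ i) {c y : List α} (hc : c.length = n + 1) (hy : y.length = n) :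
    Swappable H (k :: c) (i :: y) := by
  have hA : Swappable H (p :: q :: y) (p :: r :: y) :=
    swappable_same_first hpq hpr hqr hσ h1 h2 p q r
      (ih _ _ (by simp [hy]) (by simp [hy]) (by simp [hqr]))
  -- Here the lengths diverge: `shift p q` only exchanges the two letters in `p q y`, but deletes
  -- the first letter of `p r y`.
  have hB : Swappable H (q :: p :: y) (r :: y) :=
    hA.conj h1 (fun _ => shift_exchange p q _) (fun _ => shift_cons_cons hqr.symm _)
  obtain ⟨σ, hσ1, hσ2⟩ : ∃ σ : Equiv.Perm α, σ q = k ∧ σ r = i := by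
    -- After `q` is sent to `k`, the image of `r` is moved to `i`; the second swap does not touch
    -- `k`.
    refine ⟨Equiv.swap (Equiv.swap q k r) i * Equiv.swap q k, ?_, ?_⟩
    · simp only [Equiv.Perm.mul_apply, Equiv.swap_apply_left]
      refine Equiv.swap_apply_of_ne_of_ne (fun h => hqr ?_) hki
      have := congrArg (Equiv.swap q k) h
      simpa using this
    · simp
  have hC : Swappable H (k :: p :: y) (i :: y) := by
    simpa only [hσ1, hσ2] using swappable_permute hσ σ hB
  by_cases hcy : c = p :: y
  · rwa [hcy]
  obtain ⟨l, c', rfl⟩ : ∃ l c', c = l :: c' := by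
    cases c with
    | nil => simp at hc
    | cons l c' => exact ⟨l, c', rfl⟩
  have hD : Swappable H (k :: p :: y) (k :: l :: c') :=
    swappable_same_first hpq hpr hqr hσ h1 h2 k p l
      (ih _ _ (by simp [hy]) hc (Ne.symm hcy))
  refine (hC.symm.trans hD (fun x z h => hki (cons_injective h).1) fun x z h => ?_).symm
  exact hcy (eq_of_prepend_eq (by simpa [hy] using hc) (cons_injective h).2)

/-- Equal first letters reduce to shorter words. For different first letters the exchange goes
through a cylinder one letter shorter, disjoint from both. -/
theorem swappable_of_length_eq [DecidableEq α] {p q r s : α}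
    (hpq : p ≠ q) (hpr : p ≠ r) (hqr : q ≠ r)
    (hσ : ∀ σ, firstLetter σ ∈ H) (h1 : shift p q ∈ H) (h2 : shift r s ∈ H) (n : ℕ)
    (u v : List α) (hu : u.length = n) (hv : v.length = n) (huv : u ≠ v) : Swappable H u v := by
  induction n generalizing u v with
  | zero => simp_all
  | succ n ih =>
    obtain ⟨k, c, rfl⟩ := List.exists_cons_of_length_eq_add_one hu
    obtain ⟨j, d, rfl⟩ := List.exists_cons_of_length_eq_add_one hv
    cases n with
    | zero =>
      obtain rfl : c = [] := by simpa using hu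
      obtain rfl : d = [] := by simpa using hv
      exact swappable_singleton hσ k j
    | succ n =>
      have hc : c.length = n + 1 := by simpa using hu
      have hd : d.length = n + 1 := by simpa using hv
      by_cases hkj : k = j
      · subst hkj
        have hcd : c ≠ d := by simpa using huv
        have hs := ih c d hc hd hcd
        obtain ⟨a, c, rfl⟩ := List.exists_cons_of_length_eq_add_one hc
        obtain ⟨b, d, rfl⟩ := List.exists_cons_of_length_eq_add_one hd
        exact swappable_same_first hpq hpr hqr hσ h1 h2 k a b hs
      -- Two letters cannot exhaust the three distinct letters `p`, `q`, `r`.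
      · obtain ⟨i, hik, hij⟩ : ∃ i, k ≠ i ∧ j ≠ i := by
          by_cases hp : k ≠ p ∧ j ≠ p
          · exact ⟨p, hp⟩
          by_cases hq : k ≠ q ∧ j ≠ q
          · exact ⟨q, hq⟩
          · refine ⟨r, ?_, ?_⟩ <;> grind
        have hy : (List.replicate n p).length = n := by simp
        have hA := swappable_of_length_ne hpq hpr hqr hσ h1 h2 ih hik hc hy
        have hB := swappable_of_length_ne hpq hpr hqr hσ h1 h2 ih hij hd hy
        exact hA.trans hB.symm (fun x y h => hkj (cons_injective h).1.symm)
          fun x y h => hij (cons_injective h).1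

end Swappable

/-! ### From exchanges of cylinders to high transitivity -/

theorem eventually_pref_ne {x y : ℕ → α} (h : x ≠ y) :
    ∀ᶠ n in Filter.atTop, pref n x ≠ pref n y := by
  obtain ⟨i, hi⟩ := Function.ne_iff.1 h
  filter_upwards [Filter.eventually_gt_atTop i] with n hn h'
  exact hi (pref_eq_iff.1 h' i hn)

theorem eventually_cylinder_subset [TopologicalSpace α] {V : Set (ℕ → α)} (hV : IsOpen V)
    {w : ℕ → α} (hw : w ∈ V) :
    ∀ᶠ n in Filter.atTop, ∀ y, pref n y = pref n w → y ∈ V := by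
  obtain ⟨s, t, hs, hsV⟩ := isOpen_pi_iff.1 hV w hw
  filter_upwards [Filter.eventually_ge_atTop (s.sup id + 1)] with n hn y hy
  refine hsV fun i hi => ?_
  have : i ≤ s.sup id := Finset.le_sup (f := id) hi
  rw [pref_eq_iff.1 hy i (by omega)]
  exact (hs i hi).2

section Topology

variable [TopologicalSpace α]

theorem infinite_of_isOpen [Nontrivial α] {V : Set (ℕ → α)} (hV : IsOpen V) (hne : V.Nonempty) :
    V.Infinite := by
  classical
  obtain ⟨w, hw⟩ := hne
  obtain ⟨n, hn⟩ := (eventually_cylinder_subset hV hw).exists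
  choose f hf using fun a : α => exists_ne a
  -- Changing one letter beyond the first `n` stays in the cylinder, and different positions give
  -- different words.
  refine Set.infinite_of_injective_forall_mem
    (f := fun k : ℕ => Function.update w (n + k) (f (w (n + k)))) (fun k l hkl => ?_)
    fun k => hn _ (pref_eq_iff.2 fun i hi => Function.update_of_ne (by omega) _ _)
  by_contra hne
  have := congrFun hkl (n + k)
  simp only [Function.update_self] at this
  rw [Function.update_of_ne (by omega)] at this
  exact hf _ this

theorem exists_injective_forall_mem [Nontrivial α] (k : ℕ) (U : Fin k → Set (ℕ → α))
    (hU : ∀ i, IsOpen (U i)) (hne : ∀ i, (U i).Nonempty) :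
    ∃ x : Fin k → ℕ → α, Function.Injective x ∧ ∀ i, x i ∈ U i := by
  induction k with
  | zero => exact ⟨Fin.elim0, fun i => i.elim0, fun i => i.elim0⟩
  | succ k ih =>
    obtain ⟨x, hx, hxU⟩ := ih (fun i => U i.succ) (fun i => hU _) fun i => hne _
    obtain ⟨y, hy, hyx⟩ := (infinite_of_isOpen (hU 0) (hne 0)).exists_notMem_finite
      (Set.finite_range x)
    exact ⟨Fin.cons y x, Fin.cons_injective_iff.2 ⟨hyx, hx⟩, Fin.cases hy hxU⟩

/-- A group of homeomorphisms which exchanges any two cylinders of the same length acts highly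
topologically transitively. -/
theorem exists_forall_mem_of_swappable [Nontrivial α] {H : Subgroup (Equiv.Perm (ℕ → α))}
    (hH : ∀ u v : List α, u.length = v.length → u ≠ v → Swappable H u v) (k : ℕ)
    (U V : Fin k → Set (ℕ → α)) (hU : ∀ i, IsOpen (U i)) (hUne : ∀ i, (U i).Nonempty)
    (hV : ∀ i, IsOpen (V i)) (hVne : ∀ i, (V i).Nonempty) :
    ∃ g ∈ H, ∃ x : Fin k → ℕ → α, (∀ i, x i ∈ U i) ∧ ∀ i, g (x i) ∈ V i := by
  obtain ⟨x, hx, hxU⟩ := exists_injective_forall_mem k U hU hUne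
  suffices h : ∀ s : Finset (Fin k), ∃ g ∈ H, ∀ i ∈ s, g (x i) ∈ V i by
    obtain ⟨g, hg, h⟩ := h Finset.univ
    exact ⟨g, hg, x, hxU, fun i => h i (Finset.mem_univ i)⟩
  intro s
  induction s using Finset.induction_on with
  | empty => exact ⟨1, H.one_mem, by simp⟩
  | insert j s hj ih =>
    obtain ⟨g, hg, hgs⟩ := ih
    have hy : Function.Injective fun i => g (x i) := g.injective.comp hx
    -- Since `w` avoids all the current points, long cylinders at `w` and at `g (x j)` contain no
    -- other current point, so their exchange moves only `g (x j)`.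
    obtain ⟨w, hwV, hw⟩ := (infinite_of_isOpen (hV j) (hVne j)).exists_notMem_finite
      (Set.finite_range fun i => g (x i))
    have hw' (i : Fin k) : g (x i) ≠ w := fun h => hw ⟨i, h⟩
    obtain ⟨n, hnV, hn1, hn2⟩ := ((eventually_cylinder_subset (hV j) hwV).and
      ((Filter.eventually_all.2 fun i => eventually_pref_ne (hw' i)).and
        (Filter.eventually_all.2 fun i : {i // i ≠ j} =>
          eventually_pref_ne (hy.ne i.2)))).exists
    obtain ⟨h, hh, h1, -, h3⟩ := hH (pref n (g (x j))) (pref n w) (by simp) (hn1 j)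
    refine ⟨h * g, H.mul_mem hh hg, fun i hi => ?_⟩
    have key (u : List α) (hu : u.length = n) (z : ℕ → α) (hz : pref n z ≠ u) (y : ℕ → α) :
        z ≠ prepend u y := by
      rintro rfl
      exact hz (by rw [← hu, pref_prepend])
    by_cases hij : i = j
    · subst hij
      refine hnV _ ?_
      rw [Equiv.Perm.mul_apply]
      nth_rewrite 1 [← prepend_pref n (g (x i))]
      rw [h1]
      nth_rewrite 1 [← length_pref n w]
      rw [pref_prepend]
    · rw [Equiv.Perm.mul_apply, h3 _ (key _ (by simp) _ (hn2 ⟨i, hij⟩))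
        (key _ (by simp) _ (hn1 i))]
      exact hgs i (Finset.mem_of_mem_insert_of_ne hi hij)

end Topology

end Word

/-! ### Convolution powers of a uniform measure -/

open scoped ENNReal

/-- Conditions on the rightmost factor `a`, which is the first to act on points. -/
theorem convPow_succ_uniformOn {G : Type*} [Group G] [Countable G] [MeasurableSpace G]
    [DiscreteMeasurableSpace G] (A : Finset G) (n : ℕ) (E : Set G) :
    convPow (ProbabilityTheory.uniformOn (A : Set G)) (n + 1) E =
      (A.card : ℝ≥0∞)⁻¹ *
        ∑ a ∈ A, convPow (ProbabilityTheory.uniformOn (A : Set G)) n {g | g * a ∈ E} := by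
  set μ := ProbabilityTheory.uniformOn (A : Set G) with hμ
  have hint (f : G → ℝ≥0∞) : ∫⁻ y, f y ∂μ = (A.card : ℝ≥0∞)⁻¹ * ∑ a ∈ A, f a := by
    rw [hμ, ProbabilityTheory.uniformOn, ProbabilityTheory.cond, lintegral_smul_measure,
      Measure.count_apply_finset, lintegral_finset]
    simp
  have hE : MeasurableSet E := .of_discrete
  have : SFinite μ := by
    rw [hμ, ProbabilityTheory.uniformOn, ProbabilityTheory.cond]; infer_instance
  rw [convPow, ← lintegral_indicator_one hE,
    Measure.lintegral_mconv (measurable_of_countable _)]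
  simp_rw [hint]
  rw [lintegral_const_mul _ (measurable_of_countable _),
    lintegral_finsetSum _ fun _ _ => measurable_of_countable _]
  congr 1
  refine Finset.sum_congr rfl fun a _ => ?_
  rw [← lintegral_indicator_one (.of_discrete (s := {g | g * a ∈ E}))]
  rfl

theorem isProbabilityMeasure_convPow_uniformOn {G : Type*} [Group G] [Countable G]
    [MeasurableSpace G] [DiscreteMeasurableSpace G] {A : Finset G} (hA : A.Nonempty) (n : ℕ) :
    IsProbabilityMeasure (convPow (ProbabilityTheory.uniformOn (A : Set G)) n) := by
  induction n with
  | zero => rw [convPow]; infer_instance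
  | succ n ih =>
    refine ⟨?_⟩
    rw [convPow_succ_uniformOn]
    simp only [Set.mem_univ, Set.ofPred_true, measure_univ, Finset.sum_const, nsmul_eq_mul, mul_one]
    exact ENNReal.inv_mul_cancel (by simpa using hA.ne_empty) (by simp)

/-- If a function on a finite set is at most `c`, except for one value at most `2 c`, and two of its
values are at most `c / 2`, then its average is at most `c`. -/
theorem sum_le_card_mul {ι : Type*} {A : Finset ι} {v : ι → ℝ≥0∞} {c : ℝ≥0∞} {s b b' : ι}
    (hs : s ∈ A) (hb : b ∈ A) (hb' : b' ∈ A) (hsb : s ≠ b) (hsb' : s ≠ b') (hbb' : b ≠ b')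
    (hv : ∀ a ∈ A, a ≠ s → v a ≤ c) (hvs : v s ≤ 2 * c) (hvb : v b ≤ c / 2)
    (hvb' : v b' ≤ c / 2) : ∑ a ∈ A, v a ≤ A.card * c := by
  classical
  have h1 : b ∈ A.erase s := Finset.mem_erase.2 ⟨hsb.symm, hb⟩
  have h2 : b' ∈ (A.erase s).erase b :=
    Finset.mem_erase.2 ⟨hbb'.symm, Finset.mem_erase.2 ⟨hsb'.symm, hb'⟩⟩
  rw [← Finset.add_sum_erase _ _ hs, ← Finset.add_sum_erase _ _ h1, ← Finset.add_sum_erase _ _ h2,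
    ← Finset.card_erase_add_one hs, ← Finset.card_erase_add_one h1,
    ← Finset.card_erase_add_one h2]
  have h3 : ∑ a ∈ ((A.erase s).erase b).erase b', v a ≤
      (((A.erase s).erase b).erase b').card * c := by
    rw [← nsmul_eq_mul]
    refine Finset.sum_le_card_nsmul _ _ _ fun a ha => hv a ?_ ?_ <;> simp_all
  calc _ ≤ 2 * c + (c / 2 + (c / 2 + (((A.erase s).erase b).erase b').card * c)) := by gcongr
    _ = 2 * c + (c + (((A.erase s).erase b).erase b').card * c) := by
      rw [← add_assoc (c / 2), ENNReal.add_halves]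
    _ = _ := by push_cast; ring

/-! ### Drift of the length of a common prefix -/

namespace Word

variable {α : Type*}

/-- All words in `S` have the same first `m` letters. -/
def SharesPrefix (m : ℕ) (S : Set (ℕ → α)) : Prop :=
  ∀ x ∈ S, ∀ y ∈ S, ∀ i < m, x i = y i

theorem SharesPrefix.mono {m n : ℕ} {S : Set (ℕ → α)} (h : SharesPrefix n S) (hmn : m ≤ n) :
    SharesPrefix m S := fun x hx y hy i hi => h x hx y hy i (hi.trans_le hmn)

theorem SharesPrefix.firstLetter {m : ℕ} {S : Set (ℕ → α)} (h : SharesPrefix m S)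
    (σ : Equiv.Perm α) : SharesPrefix m (firstLetter σ '' S) := by
  rintro _ ⟨x, hx, rfl⟩ _ ⟨y, hy, rfl⟩ i hi
  have := h x hx y hy i hi
  cases i with
  | zero => simp [firstLetter_apply, this]
  | succ i => exact this

section Shift

variable [DecidableEq α]

theorem SharesPrefix.shift_of_ne {m : ℕ} {S : Set (ℕ → α)} (h : SharesPrefix m S) {p q : α}
    (hp : ∀ x ∈ S, x 0 ≠ p) : SharesPrefix (m + 1) (shift p q '' S) := by
  rintro _ ⟨x, hx, rfl⟩ _ ⟨y, hy, rfl⟩ i hi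
  simp only [shift_apply, shiftFun, hp x hx, hp y hy, if_false]
  cases i with
  | zero => rfl
  | succ i => exact h x hx y hy i (by omega)

/-- The branch of `shiftFun` depends on the first two letters only, which all words of `S` share; at
worst one letter is deleted. -/
theorem SharesPrefix.shift {m : ℕ} {S : Set (ℕ → α)} (h : SharesPrefix (m + 2) S) (p q : α) :
    SharesPrefix (m + 1) (shift p q '' S) := by
  rintro _ ⟨x, hx, rfl⟩ _ ⟨y, hy, rfl⟩ i hi
  have h := h x hx y hy
  have h0 := h 0 (by omega)
  have h1 := h 1 (by omega)
  simp only [shift_apply, shiftFun, h0, h1]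
  split_ifs
  · match i with
    | 0 => rfl
    | 1 => rfl
    | i + 2 => exact h (i + 2) (by omega)
  · exact h (i + 1) (by omega)
  · cases i with
    | zero => rfl
    | succ i => exact h i (by omega)

end Shift

variable {G : Type*} [Group G] [Countable G] [MeasurableSpace G] [DiscreteMeasurableSpace G]

/-- If every cylinder of length at least two is lengthened by two elements of `A` and shortened by at
most one of them, then the random walk scatters a cylinder with a probability which is exponentially
small in its length. -/
theorem convPow_not_sharesPrefix_le (φ : G →* Equiv.Perm (ℕ → α)) {A : Finset G}
    (hA : ∀ m, ∀ S : Set (ℕ → α), S.Nonempty → SharesPrefix (m + 2) S →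
      ∃ s ∈ A, ∃ b ∈ A, ∃ b' ∈ A, s ≠ b ∧ s ≠ b' ∧ b ≠ b' ∧
        (∀ a ∈ A, a ≠ s → SharesPrefix (m + 2) (φ a '' S)) ∧ SharesPrefix (m + 1) (φ s '' S) ∧
        SharesPrefix (m + 3) (φ b '' S) ∧ SharesPrefix (m + 3) (φ b' '' S))
    (hAne : A.Nonempty) (n m : ℕ) {S : Set (ℕ → α)} (hne : S.Nonempty)
    (hS : SharesPrefix (m + 1) S) :
    convPow (ProbabilityTheory.uniformOn (A : Set G)) n {g | ¬ SharesPrefix 1 (φ g '' S)} ≤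
      (2⁻¹ : ℝ≥0∞) ^ m := by
  induction n generalizing m S with
  | zero =>
    have h1 : ¬ (1 : G) ∈ {g | ¬ SharesPrefix 1 (φ g '' S)} := by
      simpa using hS.mono (by omega)
    rw [convPow, Measure.dirac_apply, Set.indicator_of_notMem h1]
    exact zero_le
  | succ n ih =>
    have := isProbabilityMeasure_convPow_uniformOn hAne (n + 1)
    cases m with
    -- For `m = 0` the bound is `1`, so no control on shorter cylinders is needed.
    | zero => simpa using prob_le_one
    | succ m =>
      have hset (a : G) : {g | g * a ∈ {g | ¬ SharesPrefix 1 (φ g '' S)}} =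
          {g | ¬ SharesPrefix 1 (φ g '' (φ a '' S))} := by
        ext g
        simp only [Set.mem_ofPred_eq, Set.image_image, map_mul]
        rfl
      rw [convPow_succ_uniformOn]
      simp_rw [hset]
      obtain ⟨s, hs, b, hb, b', hb', h1, h2, h3, hv, hvs, hvb, hvb'⟩ := hA m S hne hS
      have key := sum_le_card_mul (c := (2⁻¹ : ℝ≥0∞) ^ (m + 1)) hs hb hb' h1 h2 h3
        (fun a ha has => ih (m + 1) (hne.image _) (hv a ha has))
        ((ih m (hne.image _) hvs).trans_eq ?_)
        ((ih (m + 2) (hne.image _) hvb).trans_eq ?_) ((ih (m + 2) (hne.image _) hvb').trans_eq ?_)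
      · calc _ ≤ (A.card : ℝ≥0∞)⁻¹ * (A.card * (2⁻¹ : ℝ≥0∞) ^ (m + 1)) := by gcongr
          _ = _ := by
            rw [← mul_assoc, ENNReal.inv_mul_cancel (by simpa using hAne.ne_empty) (by simp),
              one_mul]
      · rw [pow_succ', ← mul_assoc, ENNReal.mul_inv_cancel (by simp) (by simp), one_mul]
      · rw [ENNReal.div_eq_inv_mul, pow_succ']
      · rw [ENNReal.div_eq_inv_mul, pow_succ']

end Word

/-- If the random walk maps `U` to a set which meets both `V` and `V'` with probability at most
`1 / 2` only, then the action is not topologically mixing. -/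
theorem not_isTopologicallyMuMixing {G X : Type*} [Group G] [Countable G] [MeasurableSpace G]
    [DiscreteMeasurableSpace G] [TopologicalSpace X] [MulAction G X] {A : Finset G}
    (hA : A.Nonempty) {U V V' : Set X} (hU : IsOpen U) (hUne : U.Nonempty) (hV : IsOpen V)
    (hVne : V.Nonempty) (hV' : IsOpen V') (hVne' : V'.Nonempty)
    (h : ∀ n, convPow (ProbabilityTheory.uniformOn (A : Set G)) n
      (hittingSet G U V ∩ hittingSet G U V') ≤ 2⁻¹) :
    ¬ IsTopologicallyMuMixing G X (ProbabilityTheory.uniformOn (A : Set G)) := by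
  intro hmix
  have key (n : ℕ) :
      convPow (ProbabilityTheory.uniformOn (A : Set G)) n (hittingSet G U V) +
      convPow (ProbabilityTheory.uniformOn (A : Set G)) n (hittingSet G U V') ≤ 1 + 2⁻¹ := by
    have := isProbabilityMeasure_convPow_uniformOn hA n
    -- By inclusion–exclusion the sum is at most `3 / 2`, whereas mixing would make it tend to `2`.
    rw [← measure_union_add_inter _ (.of_discrete)]
    exact add_le_add prob_le_one (h n)
  have hlim := le_of_tendsto' ((hmix U V hU hUne hV hVne).add (hmix U V' hU hUne hV' hVne')) key
  have h2 : (1 : ℝ≥0∞) ≤ 2⁻¹ := (ENNReal.add_le_add_iff_left ENNReal.one_ne_top).1 hlim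
  rw [ENNReal.le_inv_iff_mul_le] at h2
  norm_num at h2

/-! ### Full shifts as Cantor spaces -/

namespace Word

/-- A homeomorphism from the Cantor space to `n` copies of it, under which words with the same image
letter agree in `r` more letters than their image words do. -/
def ExpandingSplit (n r : ℕ) : Prop :=
  ∃ h : (ℕ → Bool) → Fin n × (ℕ → Bool), Continuous h ∧ Function.Bijective h ∧
    ∀ x y m, (h x).1 = (h y).1 → (∀ i < m, (h x).2 i = (h y).2 i) → ∀ i < m + r, x i = y i

theorem expandingSplit_one : ExpandingSplit 1 0 :=
  ⟨fun x => (0, x), by fun_prop, ⟨fun x y h => by simpa using h, fun ⟨i, x⟩ => ⟨x, by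
    rw [Subsingleton.elim i 0]⟩⟩, fun x y m _ h => h⟩

/-- Words starting with `false` form the new piece, and tails of words starting with `true` are
split by `h`. The removed first letter is the extra letter of agreement. -/
theorem ExpandingSplit.succ {n : ℕ} (hn : ExpandingSplit n 0) : ExpandingSplit (n + 1) 1 := by
  obtain ⟨h, hc, hb, he⟩ := hn
  refine ⟨fun x => if x 0 = true then ((h (tail x)).1.succ, (h (tail x)).2) else (0, tail x),
    ?_, ⟨fun x y hxy => ?_, fun ⟨i, z⟩ => ?_⟩, fun x y m h1 h2 i hi => ?_⟩
  · have hcl : IsClopen {x : ℕ → Bool | x 0 = true} :=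
      (isClopen_discrete {true}).preimage (continuous_apply 0)
    refine Continuous.if (fun x hx => ?_) ?_ (by exact continuous_const.prodMk continuous_tail)
    · simp [hcl.frontier_eq] at hx
    · have := hc.comp (continuous_tail (α := Bool))
      exact ((continuous_of_discreteTopology (f := Fin.succ)).comp this.fst).prodMk this.snd
  · rw [eq_cons_tail x, eq_cons_tail y]
    cases hx : x 0 <;> cases hy : y 0 <;> simp only [hx, hy, if_true, Bool.false_eq_true, if_false,
      Prod.mk.injEq, Fin.succ_inj, true_and] at hxy
    · rw [hxy]
    · exact absurd hxy.1.symm (Fin.succ_ne_zero _)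
    · exact absurd hxy.1 (Fin.succ_ne_zero _)
    · rw [hb.1 (Prod.ext hxy.1 hxy.2)]
  · refine Fin.cases ⟨cons false z, by simp⟩ (fun j => ?_) i
    obtain ⟨x, hx⟩ := hb.2 (j, z)
    exact ⟨cons true x, by simp [hx]⟩
  · cases hx : x 0 <;> cases hy : y 0 <;> simp only [hx, hy, if_true, Bool.false_eq_true, if_false,
      Fin.succ_inj] at h1 h2
    · cases i with
      | zero => rw [hx, hy]
      | succ i => exact h2 i (by omega)
    · exact absurd h1.symm (Fin.succ_ne_zero _)
    · exact absurd h1 (Fin.succ_ne_zero _)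
    · cases i with
      | zero => rw [hx, hy]
      | succ i => exact he _ _ m h1 h2 i (by omega)

theorem expandingSplit (n : ℕ) : ExpandingSplit (n + 1) 0 ∧ ExpandingSplit (n + 2) 1 := by
  induction n with
  | zero => exact ⟨expandingSplit_one, expandingSplit_one.succ⟩
  | succ n ih =>
    have : ExpandingSplit (n + 2) 0 := by
      obtain ⟨h, hc, hb, he⟩ := ih.2
      exact ⟨h, hc, hb, fun x y m h1 h2 i hi => he x y m h1 h2 i (by omega)⟩
    exact ⟨this, this.succ⟩

/-- The sequence of letters read off by iterating a map `X → L × X`. -/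
def itinerary {X L : Type*} (h : X → L × X) : ℕ → X → L
  | 0, x => (h x).1
  | n + 1, x => itinerary h n (h x).2

theorem continuous_itinerary {X L : Type*} [TopologicalSpace X] [TopologicalSpace L]
    {h : X → L × X} (hc : Continuous h) (n : ℕ) : Continuous (itinerary h n) := by
  induction n with
  | zero => exact hc.fst
  | succ n ih => exact ih.comp hc.snd

/-- Surjectivity realizes every finite itinerary; the points that follow `z` for `n` steps form a
decreasing sequence of non-empty compact sets. -/
theorem exists_itinerary_eq {X L : Type*} [TopologicalSpace X] [CompactSpace X] [Nonempty X]
    [TopologicalSpace L] [T1Space L] {h : X → L × X} (hc : Continuous h)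
    (hs : Function.Surjective h) (z : ℕ → L) : ∃ x, ∀ n, itinerary h n x = z n := by
  have hcl (n : ℕ) : IsClosed {x | ∀ k < n, itinerary h k x = z k} := by
    simp only [Set.ofPred_forall]
    exact isClosed_iInter fun k => isClosed_iInter fun _ =>
      isClosed_singleton.preimage (continuous_itinerary hc k)
  have hne (n : ℕ) (z : ℕ → L) : {x | ∀ k < n, itinerary h k x = z k}.Nonempty := by
    induction n generalizing z with
    | zero => exact ⟨Classical.arbitrary X, by simp⟩
    | succ n ih =>
      obtain ⟨y, hy⟩ := ih (tail z)
      obtain ⟨x, hx⟩ := hs (z 0, y)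
      refine ⟨x, fun k hk => ?_⟩
      cases k with
      | zero => simp [itinerary, hx]
      | succ k => simpa [itinerary, hx] using hy k (by omega)
  obtain ⟨x, hx⟩ := IsCompact.nonempty_iInter_of_sequence_nonempty_isCompact_isClosed
    (fun n => {x | ∀ k < n, itinerary h k x = z k}) (fun n x hx k hk => hx k (by omega))
    (fun n => hne n z) (hcl 0).isCompact hcl
  exact ⟨x, fun n => Set.mem_iInter.1 hx (n + 1) n (by omega)⟩

/-- A full shift on at least two letters is homeomorphic to the Cantor space. -/
theorem nonempty_homeomorph_bool (n : ℕ) : Nonempty ((ℕ → Bool) ≃ₜ (ℕ → Fin (n + 2))) := by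
  obtain ⟨h, hc, hb, he⟩ := (expandingSplit n).2
  have hcont : Continuous fun x k => itinerary h k x :=
    continuous_pi fun k => continuous_itinerary hc k
  -- Each common itinerary letter forces one more common binary letter because `r = 1`.
  have hinj (m : ℕ) (x y : ℕ → Bool) (hxy : ∀ k, itinerary h k x = itinerary h k y) :
      ∀ i < m, x i = y i := by
    induction m generalizing x y with
    | zero => simp
    | succ m ih => exact he x y m (hxy 0) (ih _ _ fun k => hxy (k + 1))
  have hbij : Function.Bijective fun x k => itinerary h k x :=
    ⟨fun x y hxy => funext fun i => hinj (i + 1) x y (congrFun hxy) i (by omega),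
      fun z => (exists_itinerary_eq hc hb.2 z).imp fun x hx => funext hx⟩
  exact ⟨Continuous.homeoOfEquivCompactToT2 (f := Equiv.ofBijective _ hbij) hcont⟩

theorem nonempty_homeomorph_fin_prod (n : ℕ) :
    Nonempty ((ℕ → Bool) ≃ₜ Fin (n + 1) × (ℕ → Bool)) := by
  obtain ⟨h, hc, hb, -⟩ := (expandingSplit n).1
  exact ⟨Continuous.homeoOfEquivCompactToT2 (f := Equiv.ofBijective _ hb) hc⟩

end Word

/-! ### The boundary of the tree as a Cantor space -/

namespace F3Boundary

instance : CompactSpace F3Boundary := by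
  have hcl : IsClosed {w : ℕ → Fin 3 × Bool |
      ∀ n, (w n).1 = (w (n + 1)).1 → (w n).2 = (w (n + 1)).2} := by
    rw [Set.ofPred_forall]
    refine isClosed_iInter fun n => ?_
    have hc : Continuous fun w : ℕ → Fin 3 × Bool => (w n, w (n + 1)) := by fun_prop
    exact (isClosed_discrete {p : (Fin 3 × Bool) × (Fin 3 × Bool) |
      p.1.1 = p.2.1 → p.1.2 = p.2.2}).preimage hc
  exact isCompact_iff_compactSpace.1 hcl.isCompact

/-- The letters which may follow the letter `l` in a reduced word. -/
abbrev Next (l : Fin 3 × Bool) : Type := {m : Fin 3 × Bool // l.1 = m.1 → l.2 = m.2}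

theorem card_next (l : Fin 3 × Bool) : Fintype.card (Next l) = 5 := by
  revert l; decide

/-- A numbering of the letters which may follow `l`. -/
noncomputable def nextEquiv (l : Fin 3 × Bool) : Next l ≃ Fin 5 :=
  Fintype.equivFinOfCardEq (card_next l)

/-- The first letter of a reduced word, followed by the numbers of the later letters. -/
noncomputable def code (w : F3Boundary) : (Fin 3 × Bool) × (ℕ → Fin 5) :=
  (w.1 0, fun n => nextEquiv (w.1 n) ⟨w.1 (n + 1), w.2 n⟩)

/-- The numbering of a letter depends on its predecessor, so letters are recovered successively from
the first one. -/
theorem code_injective : Function.Injective code := by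
  intro v w h
  have h0 : v.1 0 = w.1 0 := congrArg Prod.fst h
  refine Subtype.ext (funext fun n => ?_)
  induction n with
  | zero => exact h0
  | succ n ih =>
    have hn : nextEquiv (v.1 n) ⟨v.1 (n + 1), v.2 n⟩ = nextEquiv (w.1 n) ⟨w.1 (n + 1), w.2 n⟩ :=
      congrFun (congrArg Prod.snd h) n
    have key (l l' : Fin 3 × Bool) (hl : l = l') (m : Next l) (m' : Next l')
        (hm : nextEquiv l m = nextEquiv l' m') : m.1 = m'.1 := by
      subst hl
      rw [(nextEquiv l).injective hm]
    exact key _ _ ih _ _ hn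

theorem code_surjective : Function.Surjective code := by
  rintro ⟨l, z⟩
  let w : ℕ → Fin 3 × Bool := fun n => n.rec l fun k m => ((nextEquiv m).symm (z k)).1
  have hw (n : ℕ) : w (n + 1) = ((nextEquiv (w n)).symm (z n)).1 := rfl
  refine ⟨⟨w, fun n => ((nextEquiv (w n)).symm (z n)).2⟩, Prod.ext rfl (funext fun n => ?_)⟩
  exact (nextEquiv (w n)).apply_symm_apply (z n)

theorem continuous_code : Continuous code := by
  have hval (n : ℕ) : Continuous fun w : F3Boundary => w.1 n :=
    (continuous_apply n).comp continuous_subtype_val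
  refine (hval 0).prodMk (continuous_pi fun n => ?_)
  have : Continuous fun w : F3Boundary =>
      (⟨(w.1 n, w.1 (n + 1)), w.2 n⟩ : {p : (Fin 3 × Bool) × (Fin 3 × Bool) //
        p.1.1 = p.2.1 → p.1.2 = p.2.2}) :=
    ((hval n).prodMk (hval (n + 1))).subtype_mk _
  exact (continuous_of_discreteTopology (f := fun p : {p : (Fin 3 × Bool) × (Fin 3 × Bool) //
    p.1.1 = p.2.1 → p.1.2 = p.2.2} => nextEquiv p.1.1 ⟨p.1.2, p.2⟩)).comp this

theorem nonempty_homeomorph_bool : Nonempty (F3Boundary ≃ₜ (ℕ → Bool)) := by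
  -- The code takes values in six copies (`5 + 1`) of the full shift on five letters (`3 + 2`).
  obtain ⟨e5⟩ := Word.nonempty_homeomorph_bool 3
  obtain ⟨e6⟩ := Word.nonempty_homeomorph_fin_prod 5
  let e : F3Boundary ≃ₜ (Fin 3 × Bool) × (ℕ → Fin 5) :=
    Continuous.homeoOfEquivCompactToT2
      (f := Equiv.ofBijective code ⟨code_injective, code_surjective⟩) continuous_code
  let d : Fin 3 × Bool ≃ₜ Fin 6 :=
    { Fintype.equivFinOfCardEq (α := Fin 3 × Bool) (n := 6) (by simp) with
      continuous_toFun := continuous_of_discreteTopology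
      continuous_invFun := continuous_of_discreteTopology }
  exact ⟨e.trans ((d.prodCongr e5.symm).trans e6.symm)⟩

end F3Boundary

/-! ### The action of the free product and its two properties -/

namespace FreeProdF2S18

open Word Monoid.Coprod

/-- The action by prefix replacements on the full shift on `18` letters: the symmetric group
permutes the first letter, the free generators act by `shift 0 1` and `shift 2 3`. -/
def toPerm : FreeProdF2S18 →* Equiv.Perm (ℕ → Fin 18) :=
  lift (FreeGroup.lift ![shift 0 1, shift 2 3]) firstLetter

/-- A free generator. -/
def gen (i : Fin 2) : FreeProdF2S18 := inl (FreeGroup.of i)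

theorem toPerm_inr (σ : Equiv.Perm (Fin 18)) : toPerm (inr σ) = firstLetter σ := rfl

theorem toPerm_gen_zero : toPerm (gen 0) = shift 0 1 := by simp [toPerm, gen]

theorem toPerm_gen_one : toPerm (gen 1) = shift 2 3 := by simp [toPerm, gen]

theorem toPerm_gen_zero_inv : toPerm (gen 0)⁻¹ = shift 1 0 := by
  rw [map_inv, toPerm_gen_zero, shift_inv]

theorem toPerm_gen_one_inv : toPerm (gen 1)⁻¹ = shift 3 2 := by
  rw [map_inv, toPerm_gen_one, shift_inv]

instance : Countable FreeProdF2S18 := by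
  have : Countable (FreeGroup (Fin 2)) :=
    Function.Surjective.countable (f := FreeGroup.mk) Quot.mk_surjective
  have : Countable (FreeMonoid (FreeGroup (Fin 2) ⊕ Equiv.Perm (Fin 18))) :=
    inferInstanceAs (Countable (List _))
  exact Function.Surjective.countable (f := mk) mk_surjective

open Classical in
/-- The symmetric group together with the free generators and their inverses. -/
noncomputable def generators : Finset FreeProdF2S18 :=
  Finset.univ.image (inr : Equiv.Perm (Fin 18) →* FreeProdF2S18) ∪
    {gen 0, (gen 0)⁻¹, gen 1, (gen 1)⁻¹}

theorem mem_generators {a : FreeProdF2S18} : a ∈ generators ↔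
    (∃ σ : Equiv.Perm (Fin 18), inr σ = a) ∨
      a = gen 0 ∨ a = (gen 0)⁻¹ ∨ a = gen 1 ∨ a = (gen 1)⁻¹ := by
  simp only [generators, Finset.mem_union, Finset.mem_image, Finset.mem_univ, true_and,
    Finset.mem_insert, Finset.mem_singleton]

theorem inv_mem_generators {a : FreeProdF2S18} (ha : a ∈ generators) : a⁻¹ ∈ generators := by
  rw [mem_generators] at ha ⊢
  rcases ha with ⟨σ, rfl⟩ | rfl | rfl | rfl | rfl
  · exact Or.inl ⟨σ⁻¹, map_inv _ _⟩
  all_goals simp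

theorem closure_generators : Subgroup.closure (generators : Set FreeProdF2S18) = ⊤ := by
  rw [eq_top_iff, ← closure_range_inl_union_inr, Subgroup.closure_le, Set.union_subset_iff]
  constructor
  · rw [← MonoidHom.coe_range, SetLike.coe_subset_coe, MonoidHom.range_eq_map,
      ← FreeGroup.closure_range_of, MonoidHom.map_closure, Subgroup.closure_le]
    rintro _ ⟨_, ⟨i, rfl⟩, rfl⟩
    refine Subgroup.subset_closure (mem_generators.2 (Or.inr ?_))
    fin_cases i
    · exact Or.inl rfl
    · exact Or.inr (Or.inr (Or.inl rfl))
  · rintro _ ⟨σ, rfl⟩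
    exact Subgroup.subset_closure (mem_generators.2 (Or.inl ⟨σ, rfl⟩))

theorem continuous_toPerm (g : FreeProdF2S18) : Continuous (toPerm g) := by
  have hg : g ∈ Subgroup.closure (generators : Set FreeProdF2S18) := by
    rw [closure_generators]; trivial
  have hgen (a : FreeProdF2S18) (ha : a ∈ generators) : Continuous (toPerm a) := by
    rcases mem_generators.1 ha with ⟨σ, rfl⟩ | rfl | rfl | rfl | rfl
    · exact continuous_firstLetter σ
    · rw [toPerm_gen_zero]; exact continuous_shiftFun 0 1
    · rw [toPerm_gen_zero_inv]; exact continuous_shiftFun 1 0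
    · rw [toPerm_gen_one]; exact continuous_shiftFun 2 3
    · rw [toPerm_gen_one_inv]; exact continuous_shiftFun 3 2
  induction hg using Subgroup.closure_induction'' with
  | mem a ha => exact hgen a ha
  | inv_mem a ha => exact hgen _ (inv_mem_generators ha)
  | one => rw [map_one]; exact continuous_id
  | mul a b _ _ ha hb => rw [map_mul]; exact ha.comp hb

theorem swappable (u v : List (Fin 18)) (hl : u.length = v.length) (huv : u ≠ v) :
    Swappable toPerm.range u v :=
  swappable_of_length_eq (H := toPerm.range) (p := 0) (q := 1) (r := 2) (s := 3)
    (by decide) (by decide) (by decide)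
    (fun σ => ⟨inr σ, toPerm_inr σ⟩) ⟨gen 0, toPerm_gen_zero⟩ ⟨gen 1, toPerm_gen_one⟩
    _ u v rfl hl.symm huv

/-- The four shifts delete the distinct first letters `0`, `1`, `2`, `3`, so only one of them can
shorten. The lengthening pair `b`, `b'` is the other free generator and its inverse. -/
theorem exists_lengthening {m : ℕ} {S : Set (ℕ → Fin 18)} (hne : S.Nonempty)
    (hS : SharesPrefix (m + 2) S) :
    ∃ s ∈ generators, ∃ b ∈ generators, ∃ b' ∈ generators, s ≠ b ∧ s ≠ b' ∧ b ≠ b' ∧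
      (∀ a ∈ generators, a ≠ s → SharesPrefix (m + 2) (toPerm a '' S)) ∧
      SharesPrefix (m + 1) (toPerm s '' S) ∧
      SharesPrefix (m + 3) (toPerm b '' S) ∧ SharesPrefix (m + 3) (toPerm b' '' S) := by
  obtain ⟨x, hx⟩ := hne
  have hlong (p q : Fin 18) (h : x 0 ≠ p) : SharesPrefix (m + 3) (shift p q '' S) :=
    hS.shift_of_ne fun y hy => by rwa [hS y hy x hx 0 (by omega)]
  have hshort (p q : Fin 18) : SharesPrefix (m + 1) (shift p q '' S) := hS.shift p q
  have hperm (σ : Equiv.Perm (Fin 18)) : SharesPrefix (m + 2) (toPerm (inr σ) '' S) :=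
    hS.firstLetter σ
  have h0 : gen 0 ∈ generators := mem_generators.2 (by simp)
  have h0' : (gen 0)⁻¹ ∈ generators := mem_generators.2 (by simp)
  have h1 : gen 1 ∈ generators := mem_generators.2 (by simp)
  have h1' : (gen 1)⁻¹ ∈ generators := mem_generators.2 (by simp)
  have e1 : gen 0 ≠ (gen 0)⁻¹ := inl_injective.ne (a₂ := (FreeGroup.of 0)⁻¹) (by decide)
  have e2 : gen 1 ≠ (gen 1)⁻¹ := inl_injective.ne (a₂ := (FreeGroup.of 1)⁻¹) (by decide)
  have e3 : gen 0 ≠ gen 1 := inl_injective.ne (by decide)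
  have e4 : gen 0 ≠ (gen 1)⁻¹ := inl_injective.ne (a₂ := (FreeGroup.of 1)⁻¹) (by decide)
  have e5 : (gen 0)⁻¹ ≠ gen 1 := inl_injective.ne (a₁ := (FreeGroup.of 0)⁻¹) (by decide)
  have e6 : (gen 0)⁻¹ ≠ (gen 1)⁻¹ := fun h => e3 (inv_injective h)
  have l0 : x 0 ≠ 0 → SharesPrefix (m + 3) (toPerm (gen 0) '' S) := by
    rw [toPerm_gen_zero]; exact hlong 0 1
  have l0' : x 0 ≠ 1 → SharesPrefix (m + 3) (toPerm (gen 0)⁻¹ '' S) := by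
    rw [toPerm_gen_zero_inv]; exact hlong 1 0
  have l1 : x 0 ≠ 2 → SharesPrefix (m + 3) (toPerm (gen 1) '' S) := by
    rw [toPerm_gen_one]; exact hlong 2 3
  have l1' : x 0 ≠ 3 → SharesPrefix (m + 3) (toPerm (gen 1)⁻¹ '' S) := by
    rw [toPerm_gen_one_inv]; exact hlong 3 2
  have mono {T : Set (ℕ → Fin 18)} (h : SharesPrefix (m + 3) T) : SharesPrefix (m + 2) T :=
    h.mono (by omega)
  by_cases c1 : x 0 = 1
  · refine ⟨_, h0', _, h1, _, h1', e5, e6, e2, fun a ha has => ?_, ?_,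
      l1 (by simp [c1]), l1' (by simp [c1])⟩
    · rcases mem_generators.1 ha with ⟨σ, rfl⟩ | rfl | rfl | rfl | rfl
      exacts [hperm σ, mono (l0 (by simp [c1])), absurd rfl has, mono (l1 (by simp [c1])),
        mono (l1' (by simp [c1]))]
    · rw [toPerm_gen_zero_inv]; exact hshort 1 0
  by_cases c2 : x 0 = 2
  · refine ⟨_, h1, _, h0, _, h0', e3.symm, e5.symm, e1, fun a ha has => ?_, ?_,
      l0 (by simp [c2]), l0' (by simp [c2])⟩
    · rcases mem_generators.1 ha with ⟨σ, rfl⟩ | rfl | rfl | rfl | rfl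
      exacts [hperm σ, mono (l0 (by simp [c2])), mono (l0' (by simp [c2])), absurd rfl has,
        mono (l1' (by simp [c2]))]
    · rw [toPerm_gen_one]; exact hshort 2 3
  by_cases c3 : x 0 = 3
  · refine ⟨_, h1', _, h0, _, h0', e4.symm, e6.symm, e1, fun a ha has => ?_, ?_,
      l0 (by simp [c3]), l0' (by simp [c3])⟩
    · rcases mem_generators.1 ha with ⟨σ, rfl⟩ | rfl | rfl | rfl | rfl
      exacts [hperm σ, mono (l0 (by simp [c3])), mono (l0' (by simp [c3])), mono (l1 (by simp [c3])),
        absurd rfl has]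
    · rw [toPerm_gen_one_inv]; exact hshort 3 2
  -- The first letter is `0` or none of the four; `gen 0` serves as `s` in both cases, as the bound
  -- for `s` allows a loss without requiring it.
  · refine ⟨_, h0, _, h1, _, h1', e3, e4, e2, fun a ha has => ?_, ?_, l1 c2, l1' c3⟩
    · rcases mem_generators.1 ha with ⟨σ, rfl⟩ | rfl | rfl | rfl | rfl
      exacts [hperm σ, absurd rfl has, mono (l0' c1), mono (l1 c2), mono (l1' c3)]
    · rw [toPerm_gen_zero]; exact hshort 0 1

/-- The action of the group on a space identified with the full shift on `18` letters. -/
abbrev transportAction {X : Type*} (e : X ≃ (ℕ → Fin 18)) : MulAction FreeProdF2S18 X where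
  smul g x := e.symm (toPerm g (e x))
  one_smul x := by
    change e.symm (toPerm 1 (e x)) = x
    simp
  mul_smul g h x := by
    change e.symm (toPerm (g * h) (e x)) = e.symm (toPerm g (e (e.symm (toPerm h (e x)))))
    simp

variable {X : Type*} [TopologicalSpace X]

theorem isHighlyTopologicallyTransitive (e : X ≃ₜ (ℕ → Fin 18)) :
    letI := transportAction e.toEquiv
    IsHighlyTopologicallyTransitive FreeProdF2S18 X := by
  let _ := transportAction e.toEquiv
  refine fun k => ⟨fun {U V} hU hUne hV hVne => ?_⟩
  obtain ⟨a, ha⟩ := hUne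
  obtain ⟨b, hb⟩ := hVne
  obtain ⟨u, hu, huU⟩ := isOpen_pi_iff'.1 hU a ha
  obtain ⟨v, hv, hvV⟩ := isOpen_pi_iff'.1 hV b hb
  obtain ⟨_, ⟨g, rfl⟩, x, hx, hgx⟩ := exists_forall_mem_of_swappable swappable k
    (fun i => e '' u i) (fun i => e '' v i) (fun i => e.isOpenMap _ (hu i).1)
    (fun i => ⟨_, _, (hu i).2, rfl⟩) (fun i => e.isOpenMap _ (hv i).1)
    (fun i => ⟨_, _, (hv i).2, rfl⟩)
  refine ⟨g, g • fun i => e.symm (x i), ⟨_, huU fun i _ => ?_, rfl⟩, hvV fun i _ => ?_⟩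
  · obtain ⟨y, hy, hyx⟩ := hx i
    simpa [← hyx] using hy
  · obtain ⟨y, hy, hyx⟩ := hgx i
    change e.symm (toPerm g (e (e.symm (x i)))) ∈ v i
    simpa [← hyx] using hy

theorem not_isTopologicallyMuMixing_transportAction (e : X ≃ₜ (ℕ → Fin 18)) :
    letI := transportAction e.toEquiv
    ¬ IsTopologicallyMuMixing FreeProdF2S18 X
      (ProbabilityTheory.uniformOn (generators : Set FreeProdF2S18)) := by
  let _ := transportAction e.toEquiv
  have hgen : generators.Nonempty := ⟨gen 0, mem_generators.2 (by simp)⟩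
  have hopen (n : ℕ) (i : Fin 18) : IsOpen {x : X | e x n = i} :=
    (isOpen_discrete {i}).preimage ((continuous_apply n).comp e.continuous)
  have hne (i : Fin 18) : {x : X | e x 0 = i}.Nonempty := ⟨e.symm fun _ => i, by simp⟩
  have hUne : ({x : X | e x 0 = 0} ∩ {x : X | e x 1 = 0}).Nonempty :=
    ⟨e.symm fun _ => 0, by simp, by simp⟩
  refine not_isTopologicallyMuMixing hgen ((hopen 0 0).inter (hopen 1 0)) hUne (hopen 0 0) (hne 0)
    (hopen 0 1) (hne 1) fun n => ?_
  -- Two common letters correspond to `m = 1`, which gives the bound `1 / 2`.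
  have hS : SharesPrefix (1 + 1) (e '' ({x : X | e x 0 = 0} ∩ {x : X | e x 1 = 0})) := by
    rintro _ ⟨x, hx, rfl⟩ _ ⟨y, hy, rfl⟩ i hi
    match i with
    | 0 => exact hx.1.trans hy.1.symm
    | 1 => exact hx.2.trans hy.2.symm
  refine (measure_mono ?_).trans ((convPow_not_sharesPrefix_le toPerm
    (fun m S h h' => exists_lengthening h h') hgen n 1 (hUne.image e) hS).trans_eq (pow_one _))
  rintro g ⟨⟨_, ⟨x, hx, rfl⟩, hx0⟩, ⟨_, ⟨y, hy, rfl⟩, hy1⟩⟩ h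
  have hx0 : e (e.symm (toPerm g (e x))) 0 = 0 := hx0
  have hy1 : e (e.symm (toPerm g (e y))) 0 = 1 := hy1
  rw [e.apply_symm_apply] at hx0 hy1
  have := h _ ⟨_, ⟨x, hx, rfl⟩, rfl⟩ _ ⟨_, ⟨y, hy, rfl⟩, rfl⟩ 0 one_pos
  rw [hx0, hy1] at this
  exact absurd this (by decide)

end FreeProdF2S18

theorem proposition3p6 :
    CompactSpace F3Boundary ∧ PolishSpace F3Boundary ∧ Nonempty (F3Boundary ≃ₜ (ℕ → Bool)) ∧
    ∃ A : Finset FreeProdF2S18,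
      (∀ a ∈ A, a⁻¹ ∈ A) ∧
      Subgroup.closure (A : Set FreeProdF2S18) = ⊤ ∧
      ∃ _action : MulAction FreeProdF2S18 F3Boundary,
        (∀ g : FreeProdF2S18, Continuous (fun x : F3Boundary => g • x)) ∧
        IsHighlyTopologicallyTransitive FreeProdF2S18 F3Boundary ∧
        ¬ IsTopologicallyMuMixing FreeProdF2S18 F3Boundary
            (ProbabilityTheory.uniformOn (A : Set FreeProdF2S18)) := by
  obtain ⟨e⟩ := F3Boundary.nonempty_homeomorph_bool
  -- The alphabet has `16 + 2 = 18` letters.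
  obtain ⟨e'⟩ := Word.nonempty_homeomorph_bool 16
  let f : F3Boundary ≃ₜ (ℕ → Fin 18) := e.trans e'
  have : PolishSpace (ℕ → Bool) := { toIsCompletelyMetrizableSpace := inferInstance }
  exact ⟨inferInstance, e.isClosedEmbedding.polishSpace, ⟨e⟩, FreeProdF2S18.generators,
    fun _ => FreeProdF2S18.inv_mem_generators, FreeProdF2S18.closure_generators,
    FreeProdF2S18.transportAction f.toEquiv,
    fun g => f.symm.continuous.comp ((FreeProdF2S18.continuous_toPerm g).comp f.continuous),
    FreeProdF2S18.isHighlyTopologicallyTransitive f,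
    FreeProdF2S18.not_isTopologicallyMuMixing_transportAction f⟩
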